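/- Let $M$ be a connected smooth manifold of (finite) dimension greater than $2$ and let $\omega$ be a locally conformally symplectic (lcs) form on $M$: a smooth non-degenerate $2$-form such that every point has an open neighbourhood $U$ and a smooth function $f_U:U\to\mathbb R$ with $d(e^{-f_U}\omega)=0$ on $U$. Let $\theta$ be its Lee form, i.e. the closed $1$-form with $\theta|_U=df_U$. A presentation of $(M,\omega)$ consists of a symplectic manifold $(M_0,\omega_0)$, a discrete group $\Gamma$ acting smoothly, freely and properly on $M_0$ with $M_0/\Gamma=M$ and projection $p:M_0\to M$, a homomorphism $\rho:\Gamma\to\mathbb R$ and a smooth function $\lambda:M_0\to\mathbb R$ such that $\gamma^*\omega_0=e^{-\rho(\gamma)}\omega_0$ and $\lambda\circ\gamma-\lambda=\rho(\gamma)$ for all $\gamma\in\Gamma$, $p^*\omega=e^{\lambda}\omega_0$ and $p^*\theta=d\lambda$. A vector field $X$ on $M$ is special lcs if its lift $X_0$ to a (equivalently, any) presentation satisfies $\mathcal L_{X_0}\omega_0=0$. A smooth action of a Lie group $G$ on $M$ is special lcs if the fundamental vector field of every element of the Lie algebra of $G$ is special lcs. Let $\pi:\tilde M\to M$ be the universal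 covering, $\tilde\lambda$ a primitive of $\pi^*\theta$, and $\Gamma_0$ the group of the deck transformations $\gamma$ of $\pi$ with $\tilde\lambda\circ\gamma=\tilde\lambda$. The minimal covering is $\hat M=\tilde M/\Gamma_0$ with the induced covering $p:\hat M\to M$; on it let $\lambda$ be a primitive of $p^*\theta$ and let $\omega_0=e^{-\lambda}p^*\omega$, a symplectic form. Let $G$ be a connected Lie group with a smooth special lcs action on $(M,\omega)$. Then this action lifts to a symplectic action of $G$ on $(\hat M,\omega_0)$: there is a smooth action of $G$ on $\hat M$ such that $p(g\cdot x)=g\cdot p(x)$ and $g^*\omega_0=\omega_0$ for all $g\in G$ and $x\in\hat M$. -/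

import Mathlib

open scoped Manifold ContDiff

noncomputable section

namespace LCS

universe u

/-! Manifolds here are finite-dimensional real `C^∞` manifolds without boundary, modelled on a
normed space `E` with the model `𝓘(ℝ, E)`. -/

section Forms

variable {E : Type*} [NormedAddCommGroup E] [NormedSpace ℝ E]
  {M : Type*} [TopologicalSpace M] [ChartedSpace E M]
  {N : Type*} [TopologicalSpace N] [ChartedSpace E N]

/-- (Not necessarily smooth) differential `k`-forms on `M`. -/
abbrev DForm (E : Type*) [NormedAddCommGroup E] [NormedSpace ℝ E]
    (M : Type*) [TopologicalSpace M] [ChartedSpace E M] (k : ℕ) : Type _ :=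
  ∀ x : M, TangentSpace 𝓘(ℝ, E) x [⋀^Fin k]→L[ℝ] ℝ

/-- `1`-forms, as families of linear functionals on the tangent spaces. -/
abbrev OneForm (E : Type*) [NormedAddCommGroup E] [NormedSpace ℝ E]
    (M : Type*) [TopologicalSpace M] [ChartedSpace E M] : Type _ :=
  ∀ x : M, TangentSpace 𝓘(ℝ, E) x →L[ℝ] ℝ

/-- The pullback `f^* η` of a differential form. -/
def pullback {k : ℕ} (f : N → M) (η : DForm E M k) : DForm E N k :=
  fun y => (η (f y)).compContinuousLinearMap (mfderiv 𝓘(ℝ, E) 𝓘(ℝ, E) f y)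

/-- The expression of a form in the preferred chart at `x₀`: the pullback by the inverse of the
chart. Only its values on the target of the chart are meaningful. -/
def formInChart {k : ℕ} (η : DForm E M k) (x₀ : M) : E → E [⋀^Fin k]→L[ℝ] ℝ :=
  fun y => (η ((chartAt E x₀).symm y)).compContinuousLinearMap
    (mfderiv 𝓘(ℝ, E) 𝓘(ℝ, E) (chartAt E x₀).symm y)

/-- The expression of a vector field in the preferred chart at `x₀`. -/
def fieldInChart (X : ∀ x : M, TangentSpace 𝓘(ℝ, E) x) (x₀ : M) : E → E :=
  fun y => VectorField.mpullback 𝓘(ℝ, E) 𝓘(ℝ, E) (chartAt E x₀).symm X y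

/-- Smooth differential forms. -/
def SmoothForm {k : ℕ} (η : DForm E M k) : Prop :=
  ∀ x₀ : M, ContDiffOn ℝ ∞ (formInChart η x₀) (chartAt E x₀).target

/-- `dη = 0` on the (open) set `U`. -/
def ClosedOn {k : ℕ} (η : DForm E M k) (U : Set M) : Prop :=
  ∀ x₀ : M, ∀ y ∈ (chartAt E x₀).target, (chartAt E x₀).symm y ∈ U →
    extDeriv (formInChart η x₀) y = 0

/-- The Lie derivative `L_V η` of a `k`-form along a vector field on a vector space, evaluated
at `y` on `v₁, …, v_k`:
`(D_V η)(v₁, …, v_k) + ∑ᵢ η(v₁, …, D_{vᵢ} V, …, v_k)`. -/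
def lieDerivE {k : ℕ} (V : E → E) (η : E → E [⋀^Fin k]→L[ℝ] ℝ) (y : E) (v : Fin k → E) : ℝ :=
  fderiv ℝ η y (V y) v + ∑ i, η y (Function.update v i (fderiv ℝ V y (v i)))

/-- `L_X η = 0` on `M`. -/
def LieDerivZero {k : ℕ} (X : ∀ x : M, TangentSpace 𝓘(ℝ, E) x) (η : DForm E M k) : Prop :=
  ∀ x₀ : M, ∀ y ∈ (chartAt E x₀).target, ∀ v : Fin k → E,
    lieDerivE (fieldInChart X x₀) (formInChart η x₀) y v = 0

/-- Non-degenerate `2`-forms. -/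
def Nondegenerate (Ω : DForm E M 2) : Prop :=
  ∀ (x : M) (v : TangentSpace 𝓘(ℝ, E) x),
    (∀ w : TangentSpace 𝓘(ℝ, E) x, Ω x ![v, w] = 0) → v = 0

/-- Symplectic forms. -/
structure IsSymplectic (Ω : DForm E M 2) : Prop where
  smooth : SmoothForm Ω
  nondegenerate : Nondegenerate Ω
  closed : ClosedOn Ω Set.univ

/-- The form `e^{-f} η`. -/
def conf {k : ℕ} (f : M → ℝ) (η : DForm E M k) : DForm E M k :=
  fun x => Real.exp (-f x) • η x

/-- Locally conformally symplectic forms on a manifold of dimension greater than `2`. -/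
structure IsLCS (Ω : DForm E M 2) : Prop where
  two_lt_dim : 2 < Module.finrank ℝ E
  smooth : SmoothForm Ω
  nondegenerate : Nondegenerate Ω
  locally_conformal : ∀ x : M, ∃ U : Set M, IsOpen U ∧ x ∈ U ∧ ∃ f : M → ℝ,
    ContMDiffOn 𝓘(ℝ, E) 𝓘(ℝ) ∞ f U ∧ ClosedOn (conf f Ω) U

/-- `θ` is the Lee form of `Ω`: the `1`-form obtained by gluing the differentials `df` of the
local functions `f` such that `e^{-f} Ω` is closed. -/
def IsLeeForm (Ω : DForm E M 2) (θ : OneForm E M) : Prop :=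
  ∀ x : M, ∃ U : Set M, IsOpen U ∧ x ∈ U ∧ ∃ f : M → ℝ,
    ContMDiffOn 𝓘(ℝ, E) 𝓘(ℝ) ∞ f U ∧ ClosedOn (conf f Ω) U ∧
    ∀ z ∈ U, θ z = mfderiv 𝓘(ℝ, E) 𝓘(ℝ) f z

/-- `lam` is a smooth primitive of `p^* θ`. -/
structure IsPrimitive (p : N → M) (θ : OneForm E M) (lam : N → ℝ) : Prop where
  smooth : ContMDiff 𝓘(ℝ, E) 𝓘(ℝ) ∞ lam
  deriv_eq : ∀ y : N, mfderiv 𝓘(ℝ, E) 𝓘(ℝ) lam y =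
    (θ (p y)).comp (mfderiv 𝓘(ℝ, E) 𝓘(ℝ, E) p y)

end Forms

section Presentations

variable {E : Type*} [NormedAddCommGroup E] [NormedSpace ℝ E]

/-- `(M₀, Ω₀, Γ, ρ, lam)`, with projection `p : M₀ → M`, is a presentation of the lcs structure
`(Ω, θ)` on `M`: the discrete group `Γ` acts smoothly, freely and properly on `M₀` with quotient
manifold `M`, by symplectic homotheties `γ^* Ω₀ = e^{-ρ(γ)} Ω₀`, and `lam` is `ρ`-equivariant with
`p^* Ω = e^{lam} Ω₀` and `p^* θ = d lam`. -/
structure IsPresentation {M : Type*} [TopologicalSpace M] [ChartedSpace E M]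
    (Ω : DForm E M 2) (θ : OneForm E M)
    {M₀ : Type*} [TopologicalSpace M₀] [ChartedSpace E M₀]
    (p : M₀ → M) (Ω₀ : DForm E M₀ 2)
    (Γ : Type*) [Group Γ] [MulAction Γ M₀] (ρ : Γ →* Multiplicative ℝ) (lam : M₀ → ℝ) :
    Prop where
  symplectic : IsSymplectic Ω₀
  smooth_action : ∀ γ : Γ, ContMDiff 𝓘(ℝ, E) 𝓘(ℝ, E) ∞ (fun x : M₀ => γ • x)
  free : ∀ (γ : Γ) (x : M₀), γ • x = x → γ = 1
  proper : ProperlyDiscontinuousSMul Γ M₀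
  surjective : Function.Surjective p
  fibers : ∀ a b : M₀, p a = p b ↔ ∃ γ : Γ, γ • a = b
  local_diffeo : IsLocalDiffeomorph 𝓘(ℝ, E) 𝓘(ℝ, E) ∞ p
  homothety : ∀ γ : Γ,
    pullback (fun x : M₀ => γ • x) Ω₀ = fun x => Real.exp (-(ρ γ).toAdd) • Ω₀ x
  equivariant : ∀ (γ : Γ) (x : M₀), lam (γ • x) - lam x = (ρ γ).toAdd
  primitive : IsPrimitive p θ lam
  form_eq : pullback p Ω = fun x => Real.exp (lam x) • Ω₀ x

/-- A vector field on an lcs manifold is special lcs if its lift to a presentation is an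
infinitesimal symplectomorphism. -/
def IsSpecialField {M : Type u} [TopologicalSpace M] [ChartedSpace E M]
    (Ω : DForm E M 2) (θ : OneForm E M) (X : ∀ x : M, TangentSpace 𝓘(ℝ, E) x) : Prop :=
  ∃ (M₀ : Type u) (_ : TopologicalSpace M₀) (_ : ChartedSpace E M₀)
    (_ : IsManifold 𝓘(ℝ, E) ∞ M₀) (_ : T2Space M₀) (_ : SecondCountableTopology M₀)
    (p : M₀ → M) (Ω₀ : DForm E M₀ 2) (Γ : Type u) (_ : Group Γ) (_ : MulAction Γ M₀)
    (ρ : Γ →* Multiplicative ℝ) (lam : M₀ → ℝ),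
    IsPresentation Ω θ p Ω₀ Γ ρ lam ∧
    LieDerivZero (VectorField.mpullback 𝓘(ℝ, E) 𝓘(ℝ, E) p X) Ω₀

end Presentations

section Coverings

variable {E : Type*} [NormedAddCommGroup E] [NormedSpace ℝ E]

/-- Smooth covering maps. -/
structure IsSmoothCovering {N M : Type*} [TopologicalSpace N] [ChartedSpace E N]
    [TopologicalSpace M] [ChartedSpace E M] (p : N → M) : Prop where
  covering : IsCoveringMap p
  surjective : Function.Surjective p
  local_diffeo : IsLocalDiffeomorph 𝓘(ℝ, E) 𝓘(ℝ, E) ∞ p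

/-- For the universal covering `π : Mt → M` and a primitive `lam` of `π^* θ`, the kernel `Γ₀` of
the homomorphism `γ ↦ lam ∘ γ - lam` on the group of deck transformations of `π`. -/
def homothetyKernel {Mt M : Type*} [TopologicalSpace Mt] (π : Mt → M) (lam : Mt → ℝ) :
    Subgroup (Mt ≃ₜ Mt) where
  carrier := {γ | (∀ x, π (γ x) = π x) ∧ ∀ x, lam (γ x) - lam x = 0}
  one_mem' := ⟨fun _ => rfl, fun _ => sub_self _⟩
  mul_mem' {a b} ha hb :=
    ⟨fun x => (ha.1 (b x)).trans (hb.1 x), fun x => by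
      have h₁ := ha.2 (b x)
      have h₂ := hb.2 x
      change lam (a (b x)) - lam x = 0
      linarith⟩
  inv_mem' {a} ha :=
    ⟨fun x => by
      have h := ha.1 (a.symm x)
      rw [a.apply_symm_apply] at h
      exact h.symm, fun x => by
      have h := ha.2 (a.symm x)
      rw [a.apply_symm_apply] at h
      change lam (a.symm x) - lam x = 0
      linarith⟩

/-- `p : Mh → M` is the minimal covering determined by the Lee form `θ`: `Mh` is the quotient
manifold `Mt / Γ₀` of the universal covering `π : Mt → M` by the kernel `Γ₀` of the homomorphism
`π₁(M) → ℝ`, `γ ↦ lam ∘ γ - lam`, where `lam` is a primitive of `π^* θ`, and `p` is the map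
induced by `π`. -/
def IsMinimalCovering {M : Type u} [TopologicalSpace M] [ChartedSpace E M] (θ : OneForm E M)
    {Mh : Type*} [TopologicalSpace Mh] [ChartedSpace E Mh] (p : Mh → M) : Prop :=
  IsSmoothCovering (E := E) p ∧
  ∃ (Mt : Type u) (_ : TopologicalSpace Mt) (_ : ChartedSpace E Mt)
    (_ : IsManifold 𝓘(ℝ, E) ∞ Mt) (π : Mt → M) (lam : Mt → ℝ) (q : Mt → Mh),
    SimplyConnectedSpace Mt ∧ IsSmoothCovering (E := E) π ∧ IsPrimitive π θ lam ∧
    IsLocalDiffeomorph 𝓘(ℝ, E) 𝓘(ℝ, E) ∞ q ∧ Function.Surjective q ∧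
    (∀ a b : Mt, q a = q b ↔ ∃ γ ∈ homothetyKernel π lam, γ a = b) ∧
    ∀ a : Mt, p (q a) = π a

end Coverings

section Actions

variable {E : Type*} [NormedAddCommGroup E] [NormedSpace ℝ E]
  {EG : Type*} [NormedAddCommGroup EG] [NormedSpace ℝ EG]

/-- The fundamental vector field on `M` of an element `X` of the Lie algebra of `G`. -/
def fundamentalField {G : Type*} [TopologicalSpace G] [ChartedSpace EG G] [Group G]
    {M : Type*} [TopologicalSpace M] [ChartedSpace E M] [MulAction G M]
    (X : GroupLieAlgebra 𝓘(ℝ, EG) G) (x : M) : TangentSpace 𝓘(ℝ, E) x :=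
  mfderiv 𝓘(ℝ, EG) 𝓘(ℝ, E) (fun g : G => g • x) 1 X

/-- The action of `G` on `M` is special lcs: all fundamental fields are special lcs. -/
def IsSpecialAction (EG : Type*) [NormedAddCommGroup EG] [NormedSpace ℝ EG]
    (G : Type*) [TopologicalSpace G] [ChartedSpace EG G] [Group G]
    {M : Type u} [TopologicalSpace M] [ChartedSpace E M] [MulAction G M]
    (Ω : DForm E M 2) (θ : OneForm E M) : Prop :=
  ∀ X : GroupLieAlgebra 𝓘(ℝ, EG) G,
    IsSpecialField Ω θ (fundamentalField (E := E) (M := M) X)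

end Actions

end LCS

end

/-! If `θ = df` near the orbit point `g • z`, then the fundamental fields preserve `e^{-f} Ω` there,
so `h^*(e^{-f} Ω)` at `z` does not change as `h` runs over a small connected neighbourhood of `g`.
Taking for `f` the function `lam` read off in a sheet of the covering and following a path of `G`
from `1` to `g`, one finds over `g • p x` a point `y` such that `g^*` carries `e^{-lam y} Ω` to
`e^{-lam x} Ω`. Non-degeneracy lets this condition determine `lam y`, and a point of the minimal
covering is determined by its projection and its value of `lam`. So `y` is unique, and uniqueness
makes `(g, x) ↦ y` an action. For fixed `x`, continuity of `g • ·` at `x` is locally constant in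
`g`, hence it propagates from `g = 1` to all of `G`. -/

open scoped Topology Manifold ContDiff

namespace LCS

universe u

section Pullback

variable {E : Type*} [NormedAddCommGroup E] [NormedSpace ℝ E]
  {M : Type*} [TopologicalSpace M] [ChartedSpace E M]
  {N : Type*} [TopologicalSpace N] [ChartedSpace E N]
  {P : Type*} [TopologicalSpace P] [ChartedSpace E P] {k : ℕ}

theorem pullback_comp_apply (η : DForm E M k) {f : N → M} {h : P → N} {z : P}
    (hf : MDifferentiableAt 𝓘(ℝ, E) 𝓘(ℝ, E) f (h z))
    (hh : MDifferentiableAt 𝓘(ℝ, E) 𝓘(ℝ, E) h z) :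
    pullback (f ∘ h) η z = pullback h (pullback f η) z := by
  ext v
  simp only [pullback, mfderiv_comp z hf hh]
  rfl

theorem pullback_congr_apply (η : DForm E M k) {f h : N → M} {z : N} (hfh : f =ᶠ[𝓝 z] h) :
    pullback f η z = pullback h η z := by
  have hcomp : ∀ (a b : M) (D : E →L[ℝ] E), a = b →
      (η a : E [⋀^Fin k]→L[ℝ] ℝ).compContinuousLinearMap D =
        (η b : E [⋀^Fin k]→L[ℝ] ℝ).compContinuousLinearMap D := by
    rintro a _ D rfl; rfl
  have hd : (mfderiv 𝓘(ℝ, E) 𝓘(ℝ, E) f z : E →L[ℝ] E) = mfderiv 𝓘(ℝ, E) 𝓘(ℝ, E) h z :=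
    hfh.mfderiv_eq
  refine (hcomp _ _ (mfderiv 𝓘(ℝ, E) 𝓘(ℝ, E) f z) hfh.self_of_nhds).trans ?_
  rw [hd]
  rfl

theorem pullback_id (η : DForm E M k) : pullback id η = η := by
  ext z v
  simp only [pullback, mfderiv_id]
  rfl

theorem pullback_conf (c : M → ℝ) (η : DForm E M k) (f : N → M) :
    pullback f (conf c η) = conf (c ∘ f) (pullback f η) :=
  rfl

end Pullback

section LieDerivative

variable {E F H : Type*} [NormedAddCommGroup E] [NormedSpace ℝ E]
  [NormedAddCommGroup F] [NormedSpace ℝ F] [NormedAddCommGroup H] [NormedSpace ℝ H] {k : ℕ}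

theorem lieDerivE_congr {V V' : E → E} {η η' : E → E [⋀^Fin k]→L[ℝ] ℝ} {y : E}
    (hV : V =ᶠ[𝓝 y] V') (hη : η =ᶠ[𝓝 y] η') (v : Fin k → E) :
    lieDerivE V η y v = lieDerivE V' η' y v := by
  rw [lieDerivE, lieDerivE, hV.fderiv_eq, hη.fderiv_eq, hV.self_of_nhds, hη.self_of_nhds]

theorem lieDerivE_smul {V : E → E} {c : E → ℝ} {η : E → E [⋀^Fin k]→L[ℝ] ℝ} {y : E}
    (hc : DifferentiableAt ℝ c y) (hη : DifferentiableAt ℝ η y) (v : Fin k → E) :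
    lieDerivE V (fun z => c z • η z) y v =
      c y * lieDerivE V η y v + fderiv ℝ c y (V y) * η y v := by
  simp only [lieDerivE, fderiv_fun_smul hc hη, add_apply, smul_apply,
    ContinuousLinearMap.smulRight_apply, ContinuousAlternatingMap.add_apply,
    ContinuousAlternatingMap.smul_apply, smul_eq_mul, ← Finset.mul_sum]
  ring

theorem hasFDerivAt_fderiv_apply {A : F → H} {q₀ : F} (hA : ContDiffAt ℝ 2 A q₀) (v : F) :
    HasFDerivAt (fun q => fderiv ℝ A q v) ((fderiv ℝ (fderiv ℝ A) q₀).flip v) q₀ := by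
  have hd : DifferentiableAt ℝ (fderiv ℝ A) q₀ :=
    (hA.fderiv_right (m := 1) (by norm_num [one_add_one_eq_two])).differentiableAt (by simp)
  exact (hd.hasFDerivAt.clm_apply (hasFDerivAt_const v q₀)).congr_fderiv (by ext; simp)

theorem fderiv_comp_prodMk_left {A : F × E → H} {t : F} {y : E}
    (hA : DifferentiableAt ℝ A (t, y)) (τ : F) :
    fderiv ℝ (fun t' => A (t', y)) t τ = fderiv ℝ A (t, y) (τ, 0) := by
  have h : HasFDerivAt (fun t' => A (t', y)) _ t :=
    hA.hasFDerivAt.comp t (hasFDerivAt_prodMk_left t y)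
  simp [h.fderiv]

theorem fderiv_comp_prodMk_right {A : F × E → H} {t : F} {y : E}
    (hA : DifferentiableAt ℝ A (t, y)) (w : E) :
    fderiv ℝ (fun y' => A (t, y')) y w = fderiv ℝ A (t, y) (0, w) := by
  have h : HasFDerivAt (fun y' => A (t, y')) _ y :=
    hA.hasFDerivAt.comp y (hasFDerivAt_prodMk_right t y)
  simp [h.fderiv]

variable {A : F × E → H} {t₀ : F} {y₀ : E}

theorem hasFDerivAt_fderiv_comp_prodMk_right (hA : ContDiffAt ℝ 2 A (t₀, y₀)) (w : E) :
    HasFDerivAt (fun t => fderiv ℝ (fun y => A (t, y)) y₀ w)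
      ((fderiv ℝ (fderiv ℝ A) (t₀, y₀)).flip (0, w) ∘L .inl ℝ F E) t₀ := by
  have hleft := hasFDerivAt_prodMk_left (𝕜 := ℝ) t₀ y₀
  refine ((hasFDerivAt_fderiv_apply hA (0, w)).comp t₀ hleft).congr_of_eventuallyEq ?_
  have hd : ∀ᶠ q in 𝓝 (t₀, y₀), DifferentiableAt ℝ A q :=
    (hA.eventually (by simp)).mono fun q hq => hq.differentiableAt (by simp)
  filter_upwards [hleft.continuousAt.eventually hd] with t ht using fderiv_comp_prodMk_right ht w

theorem hasFDerivAt_fderiv_comp_prodMk_left (hA : ContDiffAt ℝ 2 A (t₀, y₀)) (τ : F) :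
    HasFDerivAt (fun y => fderiv ℝ (fun t => A (t, y)) t₀ τ)
      ((fderiv ℝ (fderiv ℝ A) (t₀, y₀)).flip (τ, 0) ∘L .inr ℝ F E) y₀ := by
  have hright := hasFDerivAt_prodMk_right (𝕜 := ℝ) t₀ y₀
  refine ((hasFDerivAt_fderiv_apply hA (τ, 0)).comp y₀ hright).congr_of_eventuallyEq ?_
  have hd : ∀ᶠ q in 𝓝 (t₀, y₀), DifferentiableAt ℝ A q :=
    (hA.eventually (by simp)).mono fun q hq => hq.differentiableAt (by simp)
  filter_upwards [hright.continuousAt.eventually hd] with y hy using fderiv_comp_prodMk_left hy τ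

theorem fderiv_fderiv_comp_prodMk_comm (hA : ContDiffAt ℝ 2 A (t₀, y₀)) (τ : F) (w : E) :
    fderiv ℝ (fun t => fderiv ℝ (fun y => A (t, y)) y₀ w) t₀ τ =
      fderiv ℝ (fun y => fderiv ℝ (fun t => A (t, y)) t₀ τ) y₀ w := by
  rw [(hasFDerivAt_fderiv_comp_prodMk_right hA w).fderiv,
    (hasFDerivAt_fderiv_comp_prodMk_left hA τ).fderiv]
  simpa using (hA.isSymmSndFDerivAt (by simp)).eq (τ, 0) (0, w)

theorem pullback_apply_eq_fderiv (f : E → E) (η : E → E [⋀^Fin k]→L[ℝ] ℝ) (y : E) (u : Fin k → E) :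
    pullback f η y u = η (f y) fun i => fderiv ℝ f y (u i) := by
  simp only [pullback, mfderiv_eq_fderiv]
  rfl

theorem fderiv_pullback_family {A : F × E → E} (hA : ContDiffAt ℝ 2 A (t₀, y₀))
    (hid : ∀ᶠ y in 𝓝 y₀, A (t₀, y) = y) {η : E → E [⋀^Fin k]→L[ℝ] ℝ}
    (hη : DifferentiableAt ℝ η y₀) (u : Fin k → E) :
    DifferentiableAt ℝ (fun t => pullback (fun y => A (t, y)) η y₀ u) t₀ ∧
    ∀ τ, fderiv ℝ (fun t => pullback (fun y => A (t, y)) η y₀ u) t₀ τ =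
      lieDerivE (fun y => fderiv ℝ (fun t => A (t, y)) t₀ τ) η y₀ u := by
  have hA₀ : A (t₀, y₀) = y₀ := hid.self_of_nhds
  have hdA : DifferentiableAt ℝ (fun t => A (t, y₀)) t₀ :=
    (hA.differentiableAt (by simp)).comp t₀ (hasFDerivAt_prodMk_left t₀ y₀).differentiableAt
  have hbase : ∀ w, fderiv ℝ (fun y => A (t₀, y)) y₀ w = w := fun w => by
    rw [Filter.EventuallyEq.fderiv_eq (f := id) hid, fderiv_id, ContinuousLinearMap.id_apply]
  have hη' : HasFDerivAt η (fderiv ℝ η y₀) (A (t₀, y₀)) := hA₀.symm ▸ hη.hasFDerivAt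
  simp only [pullback_apply_eq_fderiv]
  have h : HasFDerivAt
      (fun t => η (A (t, y₀)) fun i => fderiv ℝ (fun y => A (t, y)) y₀ (u i)) _ t₀ :=
    (hη'.comp t₀ hdA.hasFDerivAt).continuousAlternatingMap_apply
      fun i => (hasFDerivAt_fderiv_comp_prodMk_right hA (u i)).differentiableAt.hasFDerivAt
  refine ⟨h.differentiableAt, fun τ => ?_⟩
  rw [h.fderiv, lieDerivE]
  simp [hA₀, hbase, fderiv_fderiv_comp_prodMk_comm hA]

end LieDerivative

section LocalDiffeomorph

variable {E : Type*} [NormedAddCommGroup E] [NormedSpace ℝ E]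
  {M : Type*} [TopologicalSpace M] [ChartedSpace E M]
  {N : Type*} [TopologicalSpace N] [ChartedSpace E N] {k : ℕ}

theorem eventually_isLocalDiffeomorphAt {ψ : N → M} {y : N}
    (hψ : IsLocalDiffeomorphAt 𝓘(ℝ, E) 𝓘(ℝ, E) ∞ ψ y) :
    ∀ᶠ y' in 𝓝 y, IsLocalDiffeomorphAt 𝓘(ℝ, E) 𝓘(ℝ, E) ∞ ψ y' := by
  obtain ⟨Φ, hy, heq⟩ := hψ
  filter_upwards [Φ.open_source.mem_nhds hy] with y' hy' using ⟨Φ, hy', heq⟩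

theorem mfderiv_isInvertible {ψ : N → M} {y : N}
    (hψ : IsLocalDiffeomorphAt 𝓘(ℝ, E) 𝓘(ℝ, E) ∞ ψ y) :
    (mfderiv 𝓘(ℝ, E) 𝓘(ℝ, E) ψ y).IsInvertible :=
  ⟨hψ.mfderivToContinuousLinearEquiv (by simp), rfl⟩

theorem mfderiv_leftInverse_apply {ψ : N → M} {σ : M → N} {y : N}
    (hψ : MDifferentiableAt 𝓘(ℝ, E) 𝓘(ℝ, E) ψ y)
    (hσ : MDifferentiableAt 𝓘(ℝ, E) 𝓘(ℝ, E) σ (ψ y)) (hσψ : σ ∘ ψ =ᶠ[𝓝 y] id)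
    (v : TangentSpace 𝓘(ℝ, E) y) :
    (mfderiv 𝓘(ℝ, E) 𝓘(ℝ, E) σ (ψ y) (mfderiv 𝓘(ℝ, E) 𝓘(ℝ, E) ψ y v) : E) = v := by
  have hcomp := (hσ.hasMFDerivAt.comp y hψ.hasMFDerivAt).congr_of_eventuallyEq hσψ.symm
  exact DFunLike.congr_fun (hasMFDerivAt_unique hcomp (hasMFDerivAt_id y)) v

theorem mpullback_eq_mfderiv_of_leftInverse {ψ : N → M} {σ : M → N} {y : N}
    (hψ : IsLocalDiffeomorphAt 𝓘(ℝ, E) 𝓘(ℝ, E) ∞ ψ y)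
    (hσ : MDifferentiableAt 𝓘(ℝ, E) 𝓘(ℝ, E) σ (ψ y)) (hσψ : σ ∘ ψ =ᶠ[𝓝 y] id)
    (X : ∀ x : M, TangentSpace 𝓘(ℝ, E) x) :
    (VectorField.mpullback 𝓘(ℝ, E) 𝓘(ℝ, E) ψ X y : E) =
      mfderiv 𝓘(ℝ, E) 𝓘(ℝ, E) σ (ψ y) (X (ψ y)) := by
  have hinv := mfderiv_leftInverse_apply (hψ.mdifferentiableAt (by simp)) hσ hσψ
    (VectorField.mpullback 𝓘(ℝ, E) 𝓘(ℝ, E) ψ X y)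
  rw [← hinv, VectorField.mpullback_apply, (mfderiv_isInvertible hψ).self_apply_inverse]

theorem isLocalDiffeomorphAt_chart_symm [IsManifold 𝓘(ℝ, E) ∞ M] (x : M) {y : E}
    (hy : y ∈ (chartAt E x).target) :
    IsLocalDiffeomorphAt 𝓘(ℝ, E) 𝓘(ℝ, E) ∞ (chartAt E x).symm y := by
  let Φ : PartialDiffeomorph 𝓘(ℝ, E) 𝓘(ℝ, E) E M ∞ :=
    { toPartialEquiv := (chartAt E x).symm.toPartialEquiv
      open_source := (chartAt E x).open_target
      open_target := (chartAt E x).open_source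
      contMDiffOn_toFun := contMDiffOn_chart_symm
      contMDiffOn_invFun := contMDiffOn_chart }
  exact Φ.isLocalDiffeomorphAt _ _ _ hy

theorem pullback_pullback_of_rightInverse (η : DForm E M k) {h : M → M} {ψ : N → M} {σ : M → N}
    {y : N} (hψ : MDifferentiableAt 𝓘(ℝ, E) 𝓘(ℝ, E) ψ y)
    (hh : MDifferentiableAt 𝓘(ℝ, E) 𝓘(ℝ, E) h (ψ y))
    (hσ : MDifferentiableAt 𝓘(ℝ, E) 𝓘(ℝ, E) σ (h (ψ y)))
    (hψ' : MDifferentiableAt 𝓘(ℝ, E) 𝓘(ℝ, E) ψ (σ (h (ψ y))))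
    (hψσ : ψ ∘ σ =ᶠ[𝓝 (h (ψ y))] id) :
    pullback ψ (pullback h η) y = pullback (σ ∘ h ∘ ψ) (pullback ψ η) y := by
  have hhψ := hh.comp y hψ
  have heq : h ∘ ψ =ᶠ[𝓝 y] ψ ∘ (σ ∘ h ∘ ψ) :=
    (hhψ.continuousAt.eventually hψσ).mono fun _ h => h.symm
  rw [← pullback_comp_apply η hh hψ, pullback_congr_apply η heq]
  exact pullback_comp_apply η (f := ψ) (h := σ ∘ h ∘ ψ) hψ' (hσ.comp y hhψ)

end LocalDiffeomorph

section Family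

variable {E F : Type*} [NormedAddCommGroup E] [NormedSpace ℝ E]
  [NormedAddCommGroup F] [NormedSpace ℝ F]
  {A : Type*} [TopologicalSpace A] [ChartedSpace F A]
  {M : Type*} [TopologicalSpace M] [ChartedSpace E M] {k : ℕ} {a₀ : A} {y₀ : E}

theorem mfderiv_comp_apply_of_eq {σ : M → E} {c : A → M} {x : M}
    (hσ : MDifferentiableAt 𝓘(ℝ, E) 𝓘(ℝ, E) σ x) (hc : MDifferentiableAt 𝓘(ℝ, F) 𝓘(ℝ, E) c a₀)
    (hx : c a₀ = x) (τ : TangentSpace 𝓘(ℝ, F) a₀) :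
    (mfderiv 𝓘(ℝ, F) 𝓘(ℝ, E) (σ ∘ c) a₀ τ : E) =
      mfderiv 𝓘(ℝ, E) 𝓘(ℝ, E) σ x (mfderiv 𝓘(ℝ, F) 𝓘(ℝ, E) c a₀ τ : E) := by
  subst hx
  rw [mfderiv_comp a₀ hσ hc]
  rfl

theorem eventually_pullback_pullback_eq {Φ : A → M → M}
    (hΦ : ContMDiff (𝓘(ℝ, F).prod 𝓘(ℝ, E)) 𝓘(ℝ, E) ∞ (fun q : A × M => Φ q.1 q.2))
    (hid : Φ a₀ = id) {ψ : E → M} (hψ : IsLocalDiffeomorphAt 𝓘(ℝ, E) 𝓘(ℝ, E) ∞ ψ y₀)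
    (η : DForm E M k) :
    ∀ᶠ a in 𝓝 a₀, pullback ψ (pullback (Φ a) η) y₀ =
      pullback (hψ.localInverse ∘ Φ a ∘ ψ) (pullback ψ η) y₀ := by
  set σ := hψ.localInverse
  have hΦ₀ : Φ a₀ (ψ y₀) = ψ y₀ := congrFun hid _
  have horbit : ContinuousAt (fun a => Φ a (ψ y₀)) a₀ :=
    (hΦ.continuous.comp (Continuous.prodMk_left (ψ y₀))).continuousAt
  have hsource : ∀ᶠ a in 𝓝 a₀, Φ a (ψ y₀) ∈ σ.source :=
    horbit.eventually (σ.open_source.mem_nhds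
      (by simpa only [hΦ₀] using hψ.localInverse_mem_source))
  have hψ' : ∀ᶠ a in 𝓝 a₀,
      IsLocalDiffeomorphAt 𝓘(ℝ, E) 𝓘(ℝ, E) ∞ ψ (σ (Φ a (ψ y₀))) := by
    have hσ : ContinuousAt σ (Φ a₀ (ψ y₀)) :=
      hΦ₀.symm ▸ hψ.localInverse_contMDiffAt.continuousAt
    refine (hσ.comp (f := fun a => Φ a (ψ y₀)) horbit).eventually
      (p := fun y => IsLocalDiffeomorphAt _ _ _ ψ y) ?_
    simpa only [Function.comp_apply, hΦ₀, σ, hψ.localInverse_left_inv hψ.localInverse_mem_target]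
      using eventually_isLocalDiffeomorphAt hψ
  filter_upwards [hsource, hψ'] with a ha ha'
  exact pullback_pullback_of_rightInverse η (hψ.mdifferentiableAt (by simp))
    ((hΦ.comp (contMDiff_const.prodMk contMDiff_id)).mdifferentiable (by simp) _)
    (σ.mdifferentiableAt (by simp) ha) (ha'.mdifferentiableAt (by simp))
    (Filter.eventuallyEq_of_mem (σ.open_source.mem_nhds ha) hψ.localInverse_eqOn_right)

variable [IsManifold 𝓘(ℝ, F) ∞ A]

theorem hasMFDerivAt_of_comp_chart_symm {H : Type*} [NormedAddCommGroup H] [NormedSpace ℝ H]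
    {f : A → H} (hf : DifferentiableAt ℝ (f ∘ (chartAt F a₀).symm) (chartAt F a₀ a₀)) :
    HasMFDerivAt 𝓘(ℝ, F) 𝓘(ℝ, H) f a₀
      ((fderiv ℝ (f ∘ (chartAt F a₀).symm) (chartAt F a₀ a₀)).comp
        (mfderiv 𝓘(ℝ, F) 𝓘(ℝ, F) (chartAt F a₀) a₀)) := by
  have ha₀ : a₀ ∈ (chartAt F a₀).source := mem_chart_source F a₀
  have hχ : MDifferentiableAt 𝓘(ℝ, F) 𝓘(ℝ, F) (chartAt F a₀) a₀ :=
    (contMDiffOn_chart.contMDiffAt ((chartAt F a₀).open_source.mem_nhds ha₀)).mdifferentiableAt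
      (n := ∞) (by simp)
  refine (hf.hasFDerivAt.hasMFDerivAt.comp a₀ hχ.hasMFDerivAt).congr_of_eventuallyEq ?_
  filter_upwards [(chartAt F a₀).eventually_left_inverse ha₀] with a ha
  simp only [Function.comp_apply, ha]

theorem mfderiv_pullback_family_of_contMDiffAt {B : A → E → E}
    (hB : ContMDiffAt (𝓘(ℝ, F).prod 𝓘(ℝ, E)) 𝓘(ℝ, E) ∞ (fun q : A × E => B q.1 q.2) (a₀, y₀))
    (hid : B a₀ =ᶠ[𝓝 y₀] id) {η : E → E [⋀^Fin k]→L[ℝ] ℝ} (hη : DifferentiableAt ℝ η y₀)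
    (u : Fin k → E) :
    MDifferentiableAt 𝓘(ℝ, F) 𝓘(ℝ) (fun a => pullback (B a) η y₀ u) a₀ ∧
    ∀ τ : TangentSpace 𝓘(ℝ, F) a₀,
      mfderiv 𝓘(ℝ, F) 𝓘(ℝ) (fun a => pullback (B a) η y₀ u) a₀ τ =
        lieDerivE (fun y => mfderiv 𝓘(ℝ, F) 𝓘(ℝ, E) (fun a => B a y) a₀ τ) η y₀ u := by
  set χ := chartAt F a₀
  have ha₀ : χ.symm (χ a₀) = a₀ := χ.left_inv (mem_chart_source F a₀)
  have hC : ContDiffAt ℝ 2 (fun q : F × E => B (χ.symm q.1) q.2) (χ a₀, y₀) := by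
    have hB' : ContMDiffAt (𝓘(ℝ, F).prod 𝓘(ℝ, E)) 𝓘(ℝ, E) ∞ (fun q : A × E => B q.1 q.2)
        (χ.symm (χ a₀), y₀) := by rwa [ha₀]
    have hχs : ContMDiffAt 𝓘(ℝ, F) 𝓘(ℝ, F) ∞ χ.symm (χ a₀) :=
      contMDiffOn_chart_symm.contMDiffAt (χ.open_target.mem_nhds (mem_chart_target F a₀))
    have hcomp := hB'.comp (χ a₀, y₀) (hχs.prodMap (contMDiffAt_id (x := y₀)))
    rw [← contMDiffAt_iff_contDiffAt, modelWithCornersSelf_prod, ← chartedSpaceSelf_prod]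
    exact hcomp.of_le (WithTop.coe_le_coe.2 le_top)
  obtain ⟨hd, hderiv⟩ := fderiv_pullback_family hC
    (hid.mono fun y hy => by simpa only [ha₀, id] using hy) hη u
  have hmain := hasMFDerivAt_of_comp_chart_symm (f := fun a => pullback (B a) η y₀ u) hd
  have hvel : ∀ᶠ y in 𝓝 y₀,
      DifferentiableAt ℝ (fun t => B (χ.symm t) y) (χ a₀) :=
    ((hasFDerivAt_prodMk_right (𝕜 := ℝ) (χ a₀) y₀).continuousAt.eventually
      (hC.eventually (by simp))).mono fun y hy =>
        DifferentiableAt.comp (χ a₀) (f := fun t => (t, y))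
          (g := fun q : F × E => B (χ.symm q.1) q.2) (ContDiffAt.differentiableAt hy two_ne_zero)
          (hasFDerivAt_prodMk_left (χ a₀) y).differentiableAt
  refine ⟨hmain.mdifferentiableAt, fun τ => ?_⟩
  rw [hmain.mfderiv]
  refine (hderiv _).trans (lieDerivE_congr (hvel.mono fun y hy => ?_) (.refl _ _) u)
  exact (DFunLike.congr_fun
    (hasMFDerivAt_of_comp_chart_symm (f := fun a => B a y) hy).mfderiv τ).symm

theorem mfderiv_pullback_family {Φ : A → M → M}
    (hΦ : ContMDiff (𝓘(ℝ, F).prod 𝓘(ℝ, E)) 𝓘(ℝ, E) ∞ (fun q : A × M => Φ q.1 q.2))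
    (hid : Φ a₀ = id) {ψ : E → M} (hψ : IsLocalDiffeomorphAt 𝓘(ℝ, E) 𝓘(ℝ, E) ∞ ψ y₀)
    {η : DForm E M k} (hη : DifferentiableAt (F := E [⋀^Fin k]→L[ℝ] ℝ) ℝ (pullback ψ η) y₀)
    (u : Fin k → E) :
    MDifferentiableAt 𝓘(ℝ, F) 𝓘(ℝ) (fun a => pullback ψ (pullback (Φ a) η) y₀ u) a₀ ∧
    ∀ τ : TangentSpace 𝓘(ℝ, F) a₀,
      mfderiv 𝓘(ℝ, F) 𝓘(ℝ) (fun a => pullback ψ (pullback (Φ a) η) y₀ u) a₀ τ =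
        lieDerivE (VectorField.mpullback 𝓘(ℝ, E) 𝓘(ℝ, E) ψ
          fun x => (mfderiv 𝓘(ℝ, F) 𝓘(ℝ, E) (fun a => Φ a x) a₀ τ : E)) (pullback ψ η) y₀ u := by
  have hid' : ∀ x, Φ a₀ x = x := congrFun hid
  set σ := hψ.localInverse
  have hσψ : σ ∘ ψ =ᶠ[𝓝 y₀] id := hψ.localInverse_eventuallyEq_left
  have hB : ContMDiffAt (𝓘(ℝ, F).prod 𝓘(ℝ, E)) 𝓘(ℝ, E) ∞
      (fun q : A × E => (σ ∘ Φ q.1 ∘ ψ) q.2) (a₀, y₀) := by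
    have hσ : ContMDiffAt 𝓘(ℝ, E) 𝓘(ℝ, E) ∞ σ (Φ a₀ (ψ y₀)) :=
      (hid' (ψ y₀)).symm ▸ hψ.localInverse_contMDiffAt
    exact hσ.comp (a₀, y₀) (hΦ.contMDiffAt.comp (a₀, y₀)
      (contMDiffAt_id.prodMap hψ.contMDiffAt))
  obtain ⟨hd, hderiv⟩ := mfderiv_pullback_family_of_contMDiffAt (B := fun a => σ ∘ Φ a ∘ ψ) hB
    (by simpa only [hid, Function.id_comp] using hσψ) hη u
  have heq : (fun a => pullback ψ (pullback (Φ a) η) y₀ u) =ᶠ[𝓝 a₀]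
      fun a => pullback (σ ∘ Φ a ∘ ψ) (pullback ψ η) y₀ u :=
    (eventually_pullback_pullback_eq hΦ hid hψ η).mono fun a ha => DFunLike.congr_fun ha u
  refine ⟨hd.congr_of_eventuallyEq heq, fun τ => ?_⟩
  rw [heq.mfderiv_eq]
  refine (hderiv τ).trans (lieDerivE_congr ?_ (.refl _ _) u)
  filter_upwards [eventually_isLocalDiffeomorphAt hψ, hσψ.eventuallyEq_nhds,
    hψ.contMDiffAt.continuousAt.eventually
      (σ.open_source.mem_nhds hψ.localInverse_mem_source)] with y hy hσy hys
  have hσ : MDifferentiableAt 𝓘(ℝ, E) 𝓘(ℝ, E) σ (ψ y) := σ.mdifferentiableAt (by simp) hys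
  have hc : MDifferentiableAt 𝓘(ℝ, F) 𝓘(ℝ, E) (fun a => Φ a (ψ y)) a₀ :=
    (hΦ.comp (contMDiff_id.prodMk contMDiff_const)).mdifferentiable (by simp) _
  exact (mfderiv_comp_apply_of_eq hσ hc (hid' _) τ).trans
    (mpullback_eq_mfderiv_of_leftInverse hy hσ hσy
      fun x => (mfderiv 𝓘(ℝ, F) 𝓘(ℝ, E) (fun a => Φ a x) a₀ τ : E)).symm

end Family

section SpecialFields

variable {E : Type*} [NormedAddCommGroup E] [NormedSpace ℝ E]
  {M : Type u} [TopologicalSpace M] [ChartedSpace E M]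
  {N : Type*} [TopologicalSpace N] [ChartedSpace E N]

theorem IsPrimitive.mfderiv_comp_eq {P : Type*} [TopologicalSpace P] [ChartedSpace E P]
    {p : N → M} {θ : OneForm E M} {lam : N → ℝ} (hlam : IsPrimitive p θ lam)
    (hp : IsLocalDiffeomorph 𝓘(ℝ, E) 𝓘(ℝ, E) ∞ p) {f : P → N} {π : P → M} (hπ : p ∘ f = π) {z : P}
    (hf : MDifferentiableAt 𝓘(ℝ, E) 𝓘(ℝ, E) f z) :
    mfderiv 𝓘(ℝ, E) 𝓘(ℝ) (lam ∘ f) z = (θ (π z)).comp (mfderiv 𝓘(ℝ, E) 𝓘(ℝ, E) π z) := by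
  subst hπ
  rw [mfderiv_comp z (hlam.smooth.mdifferentiableAt (by simp)) hf, hlam.deriv_eq,
    mfderiv_comp z (hp.mdifferentiable (by simp) _) hf]
  rfl

variable [IsManifold 𝓘(ℝ, E) ∞ N]

theorem fieldInChart_mpullback {p : N → M} (hp : IsLocalDiffeomorph 𝓘(ℝ, E) 𝓘(ℝ, E) ∞ p)
    (X : ∀ x : M, TangentSpace 𝓘(ℝ, E) x) (m : N) {y : E} (hy : y ∈ (chartAt E m).target) :
    fieldInChart (VectorField.mpullback 𝓘(ℝ, E) 𝓘(ℝ, E) p X) m y =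
      VectorField.mpullback 𝓘(ℝ, E) 𝓘(ℝ, E) (p ∘ (chartAt E m).symm) X y := by
  have hφ := isLocalDiffeomorphAt_chart_symm m hy
  have hp' := hp ((chartAt E m).symm y)
  rw [fieldInChart, VectorField.mpullback_apply, VectorField.mpullback_apply,
    VectorField.mpullback_apply,
    mfderiv_comp y (hp'.mdifferentiableAt (by simp)) (hφ.mdifferentiableAt (by simp)),
    (mfderiv_isInvertible hp').inverse_comp_apply_of_left]
  rfl

namespace IsPresentation

variable {Ω : DForm E M 2} {θ : OneForm E M} {p : N → M} {Ω₀ : DForm E N 2}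
  {Γ : Type*} [Group Γ] [MulAction Γ N] {ρ : Γ →* Multiplicative ℝ} {lam : N → ℝ}

theorem pullback_conf_chart (h : IsPresentation Ω θ p Ω₀ Γ ρ lam) (f : M → ℝ) (m : N) {y : E}
    (hy : y ∈ (chartAt E m).target) :
    pullback (p ∘ (chartAt E m).symm) (conf f Ω) y =
      Real.exp (lam ((chartAt E m).symm y) - f (p ((chartAt E m).symm y))) •
        formInChart Ω₀ m y := by
  have hφ := (isLocalDiffeomorphAt_chart_symm m hy).mdifferentiableAt (by simp)
  rw [pullback_comp_apply _ (h.local_diffeo.mdifferentiable (by simp) _) hφ, pullback_conf,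
    h.form_eq, sub_eq_neg_add, Real.exp_add, mul_smul]
  rfl

theorem hasFDerivAt_sub_zero (h : IsPresentation Ω θ p Ω₀ Γ ρ lam) {f : M → ℝ} (m : N) {y : E}
    (hy : y ∈ (chartAt E m).target)
    (hf : MDifferentiableAt 𝓘(ℝ, E) 𝓘(ℝ) f (p ((chartAt E m).symm y)))
    (hfθ : mfderiv 𝓘(ℝ, E) 𝓘(ℝ) f (p ((chartAt E m).symm y)) = θ (p ((chartAt E m).symm y))) :
    HasFDerivAt (fun y => lam ((chartAt E m).symm y) - f (p ((chartAt E m).symm y)))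
      (0 : E →L[ℝ] ℝ) y := by
  have hφ := (isLocalDiffeomorphAt_chart_symm m hy).mdifferentiableAt (by simp)
  have hpφ := (h.local_diffeo.mdifferentiable (by simp) _).comp y hφ
  have hlam := ((h.primitive.smooth.mdifferentiableAt (by simp)).comp y hφ).hasMFDerivAt
  rw [h.primitive.mfderiv_comp_eq h.local_diffeo (f := (chartAt E m).symm)
    (π := fun y => p ((chartAt E m).symm y)) rfl hφ, ← hfθ] at hlam
  have hsub := hlam.hasFDerivAt.sub (hf.hasMFDerivAt.comp y hpφ.hasMFDerivAt).hasFDerivAt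
  exact hsub.congr_fderiv (sub_self _)

theorem lieDerivE_conf_eq_zero (h : IsPresentation Ω θ p Ω₀ Γ ρ lam)
    {X : ∀ x : M, TangentSpace 𝓘(ℝ, E) x}
    (hX : LieDerivZero (VectorField.mpullback 𝓘(ℝ, E) 𝓘(ℝ, E) p X) Ω₀) {f : M → ℝ} (m : N) {y : E}
    (hy : y ∈ (chartAt E m).target)
    (hf : MDifferentiableAt 𝓘(ℝ, E) 𝓘(ℝ) f (p ((chartAt E m).symm y)))
    (hfθ : mfderiv 𝓘(ℝ, E) 𝓘(ℝ) f (p ((chartAt E m).symm y)) = θ (p ((chartAt E m).symm y))) :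
    DifferentiableAt (F := E [⋀^Fin 2]→L[ℝ] ℝ) ℝ
      (pullback (p ∘ (chartAt E m).symm) (conf f Ω)) y ∧
    ∀ u, lieDerivE (VectorField.mpullback 𝓘(ℝ, E) 𝓘(ℝ, E) (p ∘ (chartAt E m).symm) X)
      (pullback (p ∘ (chartAt E m).symm) (conf f Ω)) y u = 0 := by
  have htarget : ∀ᶠ y' in 𝓝 y, y' ∈ (chartAt E m).target := (chartAt E m).open_target.mem_nhds hy
  have hfield := htarget.mono fun y' hy' => fieldInChart_mpullback h.local_diffeo X m hy'
  have hform := htarget.mono fun y' hy' => h.pullback_conf_chart f m hy'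
  have hΩ₀ : DifferentiableAt ℝ (formInChart Ω₀ m) y :=
    ((h.symplectic.smooth m).contDiffAt htarget).differentiableAt (by simp)
  have hc := (h.hasFDerivAt_sub_zero m hy hf hfθ).exp
  refine ⟨(hc.differentiableAt.smul hΩ₀).congr_of_eventuallyEq hform, fun u => ?_⟩
  rw [← lieDerivE_congr hfield (Filter.EventuallyEq.symm hform) u,
    lieDerivE_smul hc.differentiableAt hΩ₀, hX m y hy u, hc.fderiv]
  simp

end IsPresentation

theorem IsSpecialField.exists_lieDerivE_conf_eq_zero {Ω : DForm E M 2} {θ : OneForm E M}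
    {X : ∀ x : M, TangentSpace 𝓘(ℝ, E) x} (hX : IsSpecialField Ω θ X) {z : M} {f : M → ℝ}
    (hf : MDifferentiableAt 𝓘(ℝ, E) 𝓘(ℝ) f z) (hfθ : mfderiv 𝓘(ℝ, E) 𝓘(ℝ) f z = θ z) :
    ∃ (ψ : E → M) (y : E), IsLocalDiffeomorphAt 𝓘(ℝ, E) 𝓘(ℝ, E) ∞ ψ y ∧ ψ y = z ∧
      DifferentiableAt (F := E [⋀^Fin 2]→L[ℝ] ℝ) ℝ (pullback ψ (conf f Ω)) y ∧
      ∀ u, lieDerivE (VectorField.mpullback 𝓘(ℝ, E) 𝓘(ℝ, E) ψ X)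
        (pullback ψ (conf f Ω)) y u = 0 := by
  obtain ⟨M₀, _, _, _, _, _, p, Ω₀, Γ, _, _, ρ, lam, h, hLie⟩ := hX
  obtain ⟨m, rfl⟩ := h.surjective z
  have hm : (chartAt E m).symm (chartAt E m m) = m := (chartAt E m).left_inv (mem_chart_source E m)
  have hy : chartAt E m m ∈ (chartAt E m).target := mem_chart_target E m
  rw [← hm] at hf hfθ
  exact ⟨_, chartAt E m m, (isLocalDiffeomorphAt_chart_symm m hy).comp _ _ (h.local_diffeo _),
    congrArg p hm, h.lieDerivE_conf_eq_zero hLie m hy hf hfθ⟩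

end SpecialFields

section SpecialActions

variable {E : Type*} [NormedAddCommGroup E] [NormedSpace ℝ E]
  {EG : Type*} [NormedAddCommGroup EG] [NormedSpace ℝ EG]
  {G : Type*} [TopologicalSpace G] [ChartedSpace EG G] [Group G]
  {M : Type u} [TopologicalSpace M] [ChartedSpace E M] [MulAction G M]
  {Ω : DForm E M 2} {θ : OneForm E M} {f : M → ℝ} {z : M}

theorem pullback_mul_smul [ContMDiffSMul 𝓘(ℝ, EG) 𝓘(ℝ, E) ∞ G M] {k : ℕ} (η : DForm E M k)
    (g g' : G) :
    pullback (fun x : M => (g * g') • x) η =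
      pullback (fun x : M => g' • x) (pullback (fun x : M => g • x) η) := by
  have hd (g : G) : MDifferentiable 𝓘(ℝ, E) 𝓘(ℝ, E) fun x : M => g • x :=
    (ContMDiffSMul.contMDiff_const_smul (I := 𝓘(ℝ, EG)) (n := ∞) g).mdifferentiable (by simp)
  funext z
  simp only [mul_smul]
  exact pullback_comp_apply η (hd g _) (hd g' z)

variable [LieGroup 𝓘(ℝ, EG) ∞ G] [ContMDiffSMul 𝓘(ℝ, EG) 𝓘(ℝ, E) ∞ G M]

theorem hasMFDerivAt_pullback_smul_conf_one (hG : IsSpecialAction EG G Ω θ)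
    (hf : MDifferentiableAt 𝓘(ℝ, E) 𝓘(ℝ) f z) (hfθ : mfderiv 𝓘(ℝ, E) 𝓘(ℝ) f z = θ z)
    (v : Fin 2 → TangentSpace 𝓘(ℝ, E) z) :
    HasMFDerivAt 𝓘(ℝ, EG) 𝓘(ℝ)
      (fun g : G => pullback (fun x : M => g • x) (conf f Ω) z v) 1 0 := by
  have hderiv (X : GroupLieAlgebra 𝓘(ℝ, EG) G) :
      MDifferentiableAt 𝓘(ℝ, EG) 𝓘(ℝ)
        (fun g : G => pullback (fun x : M => g • x) (conf f Ω) z v) 1 ∧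
      mfderiv 𝓘(ℝ, EG) 𝓘(ℝ)
        (fun g : G => pullback (fun x : M => g • x) (conf f Ω) z v) 1 X = 0 := by
    obtain ⟨ψ, y, hψ, rfl, hd, hLie⟩ := (hG X).exists_lieDerivE_conf_eq_zero hf hfθ
    let u (i : Fin 2) : E := (mfderiv 𝓘(ℝ, E) 𝓘(ℝ, E) ψ y).inverse (v i)
    have hu (g : G) : pullback ψ (pullback (fun x : M => g • x) (conf f Ω)) y u =
        pullback (fun x : M => g • x) (conf f Ω) (ψ y) v :=
      congrArg (pullback (fun x : M => g • x) (conf f Ω) (ψ y))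
        (funext fun i => (mfderiv_isInvertible hψ).self_apply_inverse (v i))
    have hfamily := mfderiv_pullback_family (a₀ := (1 : G)) (Φ := fun g x => g • x)
      (contMDiff_smul (I := 𝓘(ℝ, EG))) (funext fun x => one_smul G x) hψ hd u
    rw [funext hu] at hfamily
    exact ⟨hfamily.1, (hfamily.2 X).trans (hLie u)⟩
  exact (hderiv 0).1.hasMFDerivAt.congr_mfderiv (ContinuousLinearMap.ext fun X => (hderiv X).2)

theorem hasMFDerivAt_pullback_smul_conf (hG : IsSpecialAction EG G Ω θ) (g₀ : G)
    (hf : MDifferentiableAt 𝓘(ℝ, E) 𝓘(ℝ) f (g₀ • z))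
    (hfθ : mfderiv 𝓘(ℝ, E) 𝓘(ℝ) f (g₀ • z) = θ (g₀ • z)) (v : Fin 2 → TangentSpace 𝓘(ℝ, E) z) :
    HasMFDerivAt 𝓘(ℝ, EG) 𝓘(ℝ)
      (fun g : G => pullback (fun x : M => g • x) (conf f Ω) z v) g₀ 0 := by
  have h₁ := hasMFDerivAt_pullback_smul_conf_one hG hf hfθ
    fun i => mfderiv 𝓘(ℝ, E) 𝓘(ℝ, E) (fun x : M => g₀ • x) z (v i)
  have hr : MDifferentiableAt 𝓘(ℝ, EG) 𝓘(ℝ, EG) (fun g : G => g * g₀⁻¹) g₀ :=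
    (contMDiff_mul_right (n := ∞)).mdifferentiableAt (by simp)
  rw [← mul_inv_cancel g₀] at h₁
  have h := HasMFDerivAt.comp g₀ (f := fun g : G => g * g₀⁻¹) h₁ hr.hasMFDerivAt
  rw [ContinuousLinearMap.zero_comp] at h
  refine h.congr_of_eventuallyEq (.of_forall fun g => ?_)
  have hg := DFunLike.congr_fun
    (congrFun (pullback_mul_smul (EG := EG) (conf f Ω) (g * g₀⁻¹) g₀) z) v
  rw [inv_mul_cancel_right] at hg
  exact hg

end SpecialActions

section LocallyConstant

variable {F : Type*} [NormedAddCommGroup F] [NormedSpace ℝ F]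
  {A : Type*} [TopologicalSpace A] [ChartedSpace F A] [IsManifold 𝓘(ℝ, F) ∞ A]

theorem eventually_eq_of_eventually_hasMFDerivAt_zero {f : A → ℝ} {a : A}
    (hf : ∀ᶠ b in 𝓝 a, HasMFDerivAt 𝓘(ℝ, F) 𝓘(ℝ) f b 0) : ∀ᶠ b in 𝓝 a, f b = f a := by
  set φ := chartAt F a
  have ha : φ.symm (φ a) = a := φ.left_inv (mem_chart_source F a)
  have hφ : ContinuousAt φ.symm (φ a) := φ.continuousAt_symm (mem_chart_target F a)
  obtain ⟨r, hr, hball⟩ := Metric.eventually_nhds_iff_ball.1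
    ((φ.open_target.eventually_mem (mem_chart_target F a)).and (hφ.eventually (ha.symm ▸ hf)))
  have hderiv : ∀ y ∈ Metric.ball (φ a) r, HasFDerivAt (f ∘ φ.symm) (0 : F →L[ℝ] ℝ) y := by
    intro y hy
    have hφy := isLocalDiffeomorphAt_chart_symm a (hball y hy).1
    have h := (hball y hy).2.comp y (hφy.mdifferentiableAt (by simp)).hasMFDerivAt
    rw [ContinuousLinearMap.zero_comp] at h
    exact h.hasFDerivAt
  filter_upwards [φ.eventually_left_inverse (mem_chart_source F a),
    (φ.continuousAt (mem_chart_source F a)).eventually (Metric.ball_mem_nhds _ hr)] with b hb hbr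
  have h := Metric.isOpen_ball.is_const_of_fderiv_eq_zero (convex_ball (φ a) r).isPreconnected
    (fun y hy => (hderiv y hy).differentiableAt.differentiableWithinAt)
    (fun y hy => (hderiv y hy).fderiv) hbr (Metric.mem_ball_self hr)
  simpa only [Function.comp_apply, hb, ha] using h

theorem eq_of_hasMFDerivAt_zero {f : A → ℝ} {W : Set A} (hWo : IsOpen W) (hW : IsPreconnected W)
    (hf : ∀ a ∈ W, HasMFDerivAt 𝓘(ℝ, F) 𝓘(ℝ) f a 0) {a b : A} (ha : a ∈ W) (hb : b ∈ W) :
    f a = f b := by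
  refine hW.induction₂ (fun a b => f a = f b) (fun a ha => ?_) (fun _ _ _ _ _ _ => Eq.trans)
    (fun _ _ _ _ => Eq.symm) ha hb
  exact nhdsWithin_le_nhds ((eventually_eq_of_eventually_hasMFDerivAt_zero
    ((hWo.eventually_mem ha).mono hf)).mono fun _ => Eq.symm)

theorem sub_eq_sub_of_mfderiv_eq [PreconnectedSpace A] {f h : A → ℝ}
    (hf : MDifferentiable 𝓘(ℝ, F) 𝓘(ℝ) f) (hh : MDifferentiable 𝓘(ℝ, F) 𝓘(ℝ) h)
    (hfh : ∀ a, (mfderiv 𝓘(ℝ, F) 𝓘(ℝ) f a : F →L[ℝ] ℝ) = mfderiv 𝓘(ℝ, F) 𝓘(ℝ) h a) (a b : A) :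
    f a - h a = f b - h b :=
  eq_of_hasMFDerivAt_zero (F := F) (f := fun y => f y - h y) isOpen_univ isPreconnected_univ
    (fun y _ => ((hf y).hasMFDerivAt.sub (hh y).hasMFDerivAt).congr_mfderiv
      (sub_eq_zero.2 (hfh y))) (Set.mem_univ a) (Set.mem_univ b)

end LocallyConstant

section Coverings

variable {E : Type*} [NormedAddCommGroup E] [NormedSpace ℝ E]
  {M : Type u} [TopologicalSpace M] [ChartedSpace E M]
  {N : Type*} [TopologicalSpace N] [ChartedSpace E N]
  {θ : OneForm E M} {p : N → M} {lam : N → ℝ}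

theorem contMDiffAt_of_lift {F : Type*} [NormedAddCommGroup F] [NormedSpace ℝ F] {H : Type*}
    [TopologicalSpace H] {I : ModelWithCorners ℝ F H} {A : Type*} [TopologicalSpace A]
    [ChartedSpace H A] (hp : IsLocalDiffeomorph 𝓘(ℝ, E) 𝓘(ℝ, E) ∞ p) {f : A → N} {a : A}
    (hf : ContinuousAt f a) (hpf : ContMDiffAt I 𝓘(ℝ, E) ∞ (p ∘ f) a) :
    ContMDiffAt I 𝓘(ℝ, E) ∞ f a :=
  ((hp (f a)).localInverse_contMDiffAt.comp a hpf).congr_of_eventuallyEq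
    ((hf.eventually (hp (f a)).localInverse_eventuallyEq_left).mono fun _ => Eq.symm)

theorem IsPrimitive.mfderiv_comp_section (hlam : IsPrimitive p θ lam)
    (hp : IsLocalDiffeomorph 𝓘(ℝ, E) 𝓘(ℝ, E) ∞ p) {s : M → N} {m : M}
    (hs : MDifferentiableAt 𝓘(ℝ, E) 𝓘(ℝ, E) s m) (hps : p ∘ s =ᶠ[𝓝 m] id) :
    mfderiv 𝓘(ℝ, E) 𝓘(ℝ) (lam ∘ s) m = θ m := by
  have hd : (mfderiv 𝓘(ℝ, E) 𝓘(ℝ, E) (p ∘ s) m : E →L[ℝ] E) = .id ℝ E :=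
    hps.mfderiv_eq.trans mfderiv_id
  have hθ (m' : M) (h : m' = m) : (θ m' : E →L[ℝ] ℝ) = θ m := by rw [h]
  exact (hlam.mfderiv_comp_eq hp rfl hs).trans (congrArg₂
    (ContinuousLinearMap.comp (M₁ := E) (M₂ := E)) (hθ ((p ∘ s) m) hps.self_of_nhds) hd)

theorem exists_deck_transformation {X Y : Type*} [TopologicalSpace X] [TopologicalSpace Y]
    [SimplyConnectedSpace Y] [LocallyPathConnectedSpace Y] {π : Y → X} (hπ : IsCoveringMap π)
    {a b : Y} (hab : π a = π b) : ∃ γ : Y ≃ₜ Y, π ∘ γ = π ∧ γ a = b := by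
  obtain ⟨γ, ⟨hγa, hγ⟩, -⟩ := hπ.existsUnique_continuousMap_lifts ⟨π, hπ.continuous⟩ a b hab.symm
  obtain ⟨δ, ⟨hδb, hδ⟩, -⟩ := hπ.existsUnique_continuousMap_lifts ⟨π, hπ.continuous⟩ b a hab
  have hπγ : π ∘ γ = π := hγ
  have hπδ : π ∘ δ = π := hδ
  have hδγ : δ ∘ γ = (id : Y → Y) :=
    hπ.eq_of_comp_eq (δ.continuous.comp γ.continuous) continuous_id
      (by rw [← Function.comp_assoc, hπδ, hπγ, Function.comp_id]) a (by simp [hγa, hδb])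
  have hγδ : γ ∘ δ = (id : Y → Y) :=
    hπ.eq_of_comp_eq (γ.continuous.comp δ.continuous) continuous_id
      (by rw [← Function.comp_assoc, hπγ, hπδ, Function.comp_id]) b (by simp [hγa, hδb])
  exact ⟨⟨⟨γ, δ, congrFun hδγ, congrFun hγδ⟩, γ.continuous, δ.continuous⟩, hπγ, hγa⟩

theorem IsMinimalCovering.eq_of_primitive_eq (hp : IsMinimalCovering θ p)
    (hlam : IsPrimitive p θ lam) {a b : N} (hab : p a = p b) (hlab : lam a = lam b) : a = b := by
  obtain ⟨hpc, Mt, _, _, _, π, lamt, q, _, hπ, hlamt, hq, hqs, hfib, hpq⟩ := hp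
  obtain rfl : p ∘ q = π := funext hpq
  have : LocallyPathConnectedSpace Mt := ChartedSpace.locallyPathConnectedSpace E Mt
  obtain ⟨a, rfl⟩ := hqs a
  obtain ⟨b, rfl⟩ := hqs b
  obtain ⟨γ, hγp, rfl⟩ := exists_deck_transformation hπ.covering hab
  have hγd : MDifferentiable 𝓘(ℝ, E) 𝓘(ℝ, E) γ := fun y =>
    (contMDiffAt_of_lift hπ.local_diffeo γ.continuous.continuousAt
      (hγp.symm ▸ hπ.local_diffeo.contMDiff y)).mdifferentiableAt (by simp)
  have hlamtd := hlamt.smooth.mdifferentiable (by simp)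
  have hqd := hq.mdifferentiable (by simp)
  have hlamt_γ := sub_eq_sub_of_mfderiv_eq (hlamtd.comp hγd) hlamtd fun y =>
    (hlamt.mfderiv_comp_eq hπ.local_diffeo hγp (hγd y)).trans (hlamt.deriv_eq y).symm
  have hlam_q := sub_eq_sub_of_mfderiv_eq ((hlam.smooth.mdifferentiable (by simp)).comp hqd)
    hlamtd fun y =>
    (hlam.mfderiv_comp_eq hpc.local_diffeo rfl (hqd y)).trans (hlamt.deriv_eq y).symm
  refine (hfib _ _).2 ⟨γ, ⟨congrFun hγp, fun y => (hlamt_γ y a).trans ?_⟩, rfl⟩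
  have := hlam_q a (γ a)
  simp only [Function.comp_apply] at this ⊢
  linarith

end Coverings

theorem exists_isOpen_isPreconnected_smul_mem {G M : Type*} [TopologicalSpace G]
    [LocallyConnectedSpace G] [TopologicalSpace M] [SMul G M] [ContinuousSMul G M] (g : G) {m : M}
    {U : Set M} (hU : U ∈ 𝓝 (g • m)) :
    ∃ W : Set G, IsOpen W ∧ IsPreconnected W ∧ g ∈ W ∧ ∀ᶠ m' in 𝓝 m, ∀ h ∈ W, h • m' ∈ U := by
  obtain ⟨W', hW', V, hV, hWV⟩ := Filter.mem_prod_iff.1 (nhds_prod_eq (x := g) (y := m) ▸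
    (continuous_smul.continuousAt (x := (g, m))).preimage_mem_nhds hU)
  obtain ⟨W, hWW', hWo, hg, hW⟩ :=
    locallyConnectedSpace_iff_subsets_isOpen_isConnected.1 ‹_› g W' hW'
  exact ⟨W, hWo, hW.isPreconnected, hg, Filter.mem_of_superset hV
    fun m' hm' h hh => hWV (Set.mk_mem_prod (hWW' hh) hm')⟩

section ConformalLifts

variable {E : Type*} [NormedAddCommGroup E] [NormedSpace ℝ E]
  {EG : Type*} [NormedAddCommGroup EG] [NormedSpace ℝ EG]
  {G : Type*} [Group G]
  {M : Type u} [TopologicalSpace M] [ChartedSpace E M] [MulAction G M]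
  {N : Type*} {Ω : DForm E M 2} {θ : OneForm E M} {p : N → M} {lam : N → ℝ}

/-- The point `y` is a candidate for `g • x` under the lifted action: it lies over `g • p x`, and
`lam y - lam x` is the logarithm of the conformal factor of `g` at `p x`, so that `g^*` maps the
form `e^{-lam} Ω` at `y` to the one at `x`. -/
def IsConformalLift (Ω : DForm E M 2) (p : N → M) (lam : N → ℝ) (g : G) (x y : N) : Prop :=
  p y = g • p x ∧
    Real.exp (-lam y) • pullback (fun m : M => g • m) Ω (p x) = Real.exp (-lam x) • Ω (p x)

theorem IsConformalLift.one (x : N) : IsConformalLift Ω p lam (1 : G) x x := by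
  have hid : (fun m : M => (1 : G) • m) = id := funext (one_smul G)
  exact ⟨(one_smul G _).symm, by rw [hid, pullback_id]⟩

theorem IsConformalLift.primitive_eq [Nontrivial E] (hΩ : Nondegenerate Ω) {g : G} {x y w : N}
    (hy : IsConformalLift Ω p lam g x y) (hw : IsConformalLift Ω p lam g x w) :
    lam y = lam w := by
  obtain ⟨e, he⟩ := exists_ne (0 : E)
  obtain ⟨e', he'⟩ : ∃ e' : E, Ω (p x) ![e, e'] ≠ 0 := by
    by_contra! h
    exact he (hΩ (p x) e h)
  have hxy : Real.exp (-lam y) * pullback (fun m : M => g • m) Ω (p x) ![e, e'] =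
      Real.exp (-lam x) * Ω (p x) ![e, e'] := DFunLike.congr_fun hy.2 ![e, e']
  have hwy := DFunLike.congr_fun (hy.2.trans hw.2.symm) ![e, e']
  exact neg_injective (Real.exp_injective (mul_right_cancel₀
    (right_ne_zero_of_mul (hxy ▸ mul_ne_zero (Real.exp_ne_zero _) he')) hwy))

variable [TopologicalSpace G] [ChartedSpace EG G]

theorem IsConformalLift.mul [ContMDiffSMul 𝓘(ℝ, EG) 𝓘(ℝ, E) ∞ G M] {g h : G} {x y w : N}
    (hh : IsConformalLift Ω p lam h y w) (hg : IsConformalLift Ω p lam g x y) :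
    IsConformalLift Ω p lam (h * g) x w := by
  refine ⟨by rw [hh.1, hg.1, mul_smul], ?_⟩
  have hy (m : M) (hm : p y = m) : Real.exp (-lam w) • pullback (fun m : M => h • m) Ω m =
      Real.exp (-lam y) • Ω m := hm ▸ hh.2
  have hgy := congrArg (fun η => η.compContinuousLinearMap
    (mfderiv 𝓘(ℝ, E) 𝓘(ℝ, E) (fun m : M => g • m) (p x))) (hy _ hg.1)
  rw [pullback_mul_smul (EG := EG)]
  exact hgy.trans hg.2

variable [TopologicalSpace N] [ChartedSpace E N]

theorem IsConformalLift.pullback_conf [ContMDiffSMul 𝓘(ℝ, EG) 𝓘(ℝ, E) ∞ G M]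
    (hp : MDifferentiable 𝓘(ℝ, E) 𝓘(ℝ, E) p) {g : G} {f : N → N}
    (hf : MDifferentiable 𝓘(ℝ, E) 𝓘(ℝ, E) f) (hgf : ∀ x, IsConformalLift Ω p lam g x (f x)) :
    pullback f (conf lam (pullback p Ω)) = conf lam (pullback p Ω) := by
  have hg : MDifferentiable 𝓘(ℝ, E) 𝓘(ℝ, E) fun m : M => g • m :=
    (ContMDiffSMul.contMDiff_const_smul (I := 𝓘(ℝ, EG)) (n := ∞) g).mdifferentiable (by simp)
  have hpf : p ∘ f = (fun m : M => g • m) ∘ p := funext fun x => (hgf x).1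
  funext x
  have hpull : pullback f (pullback p Ω) x = pullback p (pullback (fun m : M => g • m) Ω) x := by
    rw [← pullback_comp_apply Ω (hp _) (hf x), hpf, pullback_comp_apply Ω (hg _) (hp x)]
  have hx := congrArg (fun η => η.compContinuousLinearMap (mfderiv 𝓘(ℝ, E) 𝓘(ℝ, E) p x)) (hgf x).2
  exact (congrArg (Real.exp (-lam (f x)) • ·) hpull).trans hx

variable [LieGroup 𝓘(ℝ, EG) ∞ G] [ContMDiffSMul 𝓘(ℝ, EG) 𝓘(ℝ, E) ∞ G M]

theorem IsConformalLift.of_section (hG : IsSpecialAction EG G Ω θ)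
    (hp : IsLocalDiffeomorph 𝓘(ℝ, E) 𝓘(ℝ, E) ∞ p) (hlam : IsPrimitive p θ lam)
    {U : Set M} (hU : IsOpen U) {s : M → N} (hs : ContMDiffOn 𝓘(ℝ, E) 𝓘(ℝ, E) ∞ s U)
    (hps : Set.EqOn (p ∘ s) id U) {W : Set G} (hWo : IsOpen W) (hW : IsPreconnected W) {x : N}
    (hWU : ∀ g ∈ W, g • p x ∈ U) {g h : G} (hg : g ∈ W) (hh : h ∈ W)
    (hgx : IsConformalLift Ω p lam g x (s (g • p x))) :
    IsConformalLift Ω p lam h x (s (h • p x)) := by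
  have hsd {m : M} (hm : m ∈ U) : MDifferentiableAt 𝓘(ℝ, E) 𝓘(ℝ, E) s m :=
    (hs.contMDiffAt (hU.mem_nhds hm)).mdifferentiableAt (by simp)
  have hconst (v : Fin 2 → TangentSpace 𝓘(ℝ, E) (p x)) :
      pullback (fun m : M => h • m) (conf (lam ∘ s) Ω) (p x) v =
        pullback (fun m : M => g • m) (conf (lam ∘ s) Ω) (p x) v :=
    eq_of_hasMFDerivAt_zero hWo hW (fun g' hg' => hasMFDerivAt_pullback_smul_conf hG g'
      ((hlam.smooth.mdifferentiableAt (by simp)).comp _ (hsd (hWU g' hg')))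
      (hlam.mfderiv_comp_section hp (hsd (hWU g' hg'))
        (hps.eventuallyEq_of_mem (hU.mem_nhds (hWU g' hg')))) v) hh hg
  exact ⟨hps (hWU h hh), (ContinuousAlternatingMap.ext hconst).trans hgx.2⟩

theorem exists_isConformalLift [ConnectedSpace G] (hG : IsSpecialAction EG G Ω θ)
    (hp : IsSmoothCovering (E := E) p) (hlam : IsPrimitive p θ lam) (g : G) (x : N) :
    ∃ y, IsConformalLift Ω p lam g x y := by
  have : LocallyPathConnectedSpace G := ChartedSpace.locallyPathConnectedSpace EG G
  have : LocallyConnectedSpace G := ChartedSpace.locallyConnectedSpace EG G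
  have : PathConnectedSpace G := pathConnectedSpace_iff_connectedSpace.2 ‹_›
  have : ContinuousSMul G M := ContMDiffSMul.continuousSMul (I := 𝓘(ℝ, EG)) (I' := 𝓘(ℝ, E)) ∞
  let γ : Path (1 : G) g := PathConnectedSpace.somePath 1 g
  obtain ⟨Γ, hΓ, hΓ₀⟩ := hp.covering.exists_path_lifts
    ⟨fun t => γ t • p x, by fun_prop⟩ x (by simp)
  have hpΓ (t : unitInterval) : p (Γ t) = γ t • p x := congrFun hΓ t
  suffices h : IsConformalLift Ω p lam (γ 0) x (Γ 0) → IsConformalLift Ω p lam (γ 1) x (Γ 1) by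
    rw [γ.source, γ.target, hΓ₀] at h
    exact ⟨_, h (.one x)⟩
  refine PreconnectedSpace.induction₂' (fun t t' => IsConformalLift Ω p lam (γ t) x (Γ t) →
    IsConformalLift Ω p lam (γ t') x (Γ t')) (fun t₀ => ?_) ⟨fun _ _ _ h h' => h' ∘ h⟩ 0 1
  have hy := hp.local_diffeo (Γ t₀)
  obtain ⟨W, hWo, hW, hγW, hWU⟩ := exists_isOpen_isPreconnected_smul_mem (γ t₀)
    (hpΓ t₀ ▸ hy.localInverse.open_source.mem_nhds hy.localInverse_mem_source)
  have hΓy {t : unitInterval} (ht : (hy.localInverse ∘ p) (Γ t) = Γ t) :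
      IsConformalLift Ω p lam (γ t) x (Γ t) ↔
        IsConformalLift Ω p lam (γ t) x (hy.localInverse (γ t • p x)) := by
    rw [← hpΓ]
    exact iff_of_eq (congrArg _ ht.symm)
  have hsec {g h : G} (hg : g ∈ W) (hh : h ∈ W) := IsConformalLift.of_section hG hp.local_diffeo
    hlam hy.localInverse.open_source hy.localInverse_contMDiffOn hy.localInverse_eqOn_right
    hWo hW hWU.self_of_nhds hg hh
  filter_upwards [γ.continuous.continuousAt.eventually (hWo.mem_nhds hγW),
    Γ.continuous.continuousAt.eventually hy.localInverse_eventuallyEq_left] with t htW ht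
  rw [hΓy ht, hΓy hy.localInverse_eventuallyEq_left.self_of_nhds]
  exact ⟨hsec hγW htW, hsec htW hγW⟩

end ConformalLifts

section Continuity

variable {E : Type*} [NormedAddCommGroup E] [NormedSpace ℝ E] [Nontrivial E]
  {EG : Type*} [NormedAddCommGroup EG] [NormedSpace ℝ EG]
  {G : Type*} [Group G] {M : Type u} [TopologicalSpace M] [ChartedSpace E M] [MulAction G M]
  {N : Type*} [TopologicalSpace N] [ChartedSpace E N]
  {Ω : DForm E M 2} {θ : OneForm E M} {p : N → M} {lam : N → ℝ}

theorem IsMinimalCovering.isConformalLift_unique (hp : IsMinimalCovering θ p)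
    (hlam : IsPrimitive p θ lam) (hΩ : Nondegenerate Ω) {g : G} {x y w : N}
    (hy : IsConformalLift Ω p lam g x y) (hw : IsConformalLift Ω p lam g x w) : y = w :=
  hp.eq_of_primitive_eq hlam (hy.1.trans hw.1.symm) (hy.primitive_eq hΩ hw)

variable [TopologicalSpace G] [ChartedSpace EG G] [LieGroup 𝓘(ℝ, EG) ∞ G]
  [ContMDiffSMul 𝓘(ℝ, EG) 𝓘(ℝ, E) ∞ G M]

theorem exists_nhds_continuousAt_of_isConformalLift (hΩ : Nondegenerate Ω)
    (hG : IsSpecialAction EG G Ω θ) (hp : IsMinimalCovering θ p) (hlam : IsPrimitive p θ lam)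
    {act : G → N → N} (hact : ∀ g x, IsConformalLift Ω p lam g x (act g x)) (g₀ : G) (x : N) :
    ∃ W ∈ 𝓝 g₀, ∀ g ∈ W, ContinuousAt (act g) x → ∀ h ∈ W,
      ContinuousAt (fun q : G × N => act q.1 q.2) (h, x) := by
  have : LocallyConnectedSpace G := ChartedSpace.locallyConnectedSpace EG G
  have : ContinuousSMul G M := ContMDiffSMul.continuousSMul (I := 𝓘(ℝ, EG)) (I' := 𝓘(ℝ, E)) ∞
  have hpc : Continuous p := hp.1.covering.continuous
  have hy := hp.1.local_diffeo (act g₀ x)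
  set s := hy.localInverse
  obtain ⟨W, hWo, hW, hg₀, hWU⟩ := exists_isOpen_isPreconnected_smul_mem g₀
    ((hact g₀ x).1 ▸ s.open_source.mem_nhds hy.localInverse_mem_source)
  have hact_eq {x' : N} (hx' : ∀ g ∈ W, g • p x' ∈ s.source) {g h : G} (hg : g ∈ W) (hh : h ∈ W)
      (hgx' : act g x' ∈ s.target) : act h x' = s (h • p x') :=
    hp.isConformalLift_unique hlam hΩ (hact h x') (.of_section hG hp.1.local_diffeo hlam
      s.open_source hy.localInverse_contMDiffOn hy.localInverse_eqOn_right hWo hW hx' hg hh (by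
        rw [← (hact g x').1, hy.localInverse_left_inv hgx']
        exact hact g x'))
  refine ⟨W, hWo.mem_nhds hg₀, fun g hg hc h hh => ?_⟩
  have hx := hWU.self_of_nhds
  have hgx : act g x ∈ s.target := by
    rw [hact_eq hx hg₀ hg hy.localInverse_mem_target]
    exact s.map_source (hx g hg)
  have hs : ContinuousAt (fun q : G × N => s (q.1 • p q.2)) (h, x) :=
    (hy.localInverse_contMDiffOn.continuousOn.continuousAt
      (s.open_source.mem_nhds (hx h hh))).comp (f := fun q : G × N => q.1 • p q.2) (by fun_prop)
  refine hs.congr (((hWo.eventually_mem hh).prod_nhds ((hpc.continuousAt.eventually hWU).and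
    (hc.eventually (s.open_target.eventually_mem hgx)))).mono fun q hq => ?_)
  exact (hact_eq hq.2.1 hg hq.1 hq.2.2).symm

theorem continuous_of_isConformalLift [ConnectedSpace G] (hΩ : Nondegenerate Ω)
    (hG : IsSpecialAction EG G Ω θ) (hp : IsMinimalCovering θ p) (hlam : IsPrimitive p θ lam)
    {act : G → N → N} (hact : ∀ g x, IsConformalLift Ω p lam g x (act g x)) :
    Continuous fun q : G × N => act q.1 q.2 := by
  have hlocal := exists_nhds_continuousAt_of_isConformalLift hΩ hG hp hlam hact
  have hslice {g : G} {x : N} (h : ContinuousAt (fun q : G × N => act q.1 q.2) (g, x)) :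
      ContinuousAt (act g) x :=
    h.comp (f := fun y : N => (g, y)) (by fun_prop)
  have hone : act 1 = id :=
    funext fun x => hp.isConformalLift_unique hlam hΩ (hact 1 x) (.one x)
  refine continuous_iff_continuousAt.2 fun ⟨g, x⟩ => ?_
  have hg : ContinuousAt (act 1) x → ContinuousAt (act g) x := by
    refine PreconnectedSpace.induction₂' (fun g h => ContinuousAt (act g) x →
      ContinuousAt (act h) x) (fun g₀ => ?_) ⟨fun _ _ _ h h' => h' ∘ h⟩ 1 g
    obtain ⟨W, hW, hWc⟩ := hlocal g₀ x
    filter_upwards [hW] with h hh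
    exact ⟨fun hc => hslice (hWc g₀ (mem_of_mem_nhds hW) hc h hh),
      fun hc => hslice (hWc h hh hc g₀ (mem_of_mem_nhds hW))⟩
  obtain ⟨W, hW, hWc⟩ := hlocal g x
  exact hWc g (mem_of_mem_nhds hW) (hg (hone ▸ continuousAt_id)) g (mem_of_mem_nhds hW)

end Continuity

theorem lemma4p5_general
    {E : Type*} [NormedAddCommGroup E] [NormedSpace ℝ E] [Nontrivial E]
    {EG : Type*} [NormedAddCommGroup EG] [NormedSpace ℝ EG]
    {G : Type*} [TopologicalSpace G] [ChartedSpace EG G] [Group G]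
    [LieGroup 𝓘(ℝ, EG) ∞ G] [ConnectedSpace G]
    {M : Type*} [TopologicalSpace M] [ChartedSpace E M]
    (Ω : DForm E M 2) (θ : OneForm E M) (hΩ : Nondegenerate Ω) (hθ : IsLeeForm Ω θ)
    [MulAction G M] [ContMDiffSMul 𝓘(ℝ, EG) 𝓘(ℝ, E) ∞ G M]
    (hG : IsSpecialAction EG G Ω θ)
    {Mh : Type*} [TopologicalSpace Mh] [ChartedSpace E Mh]
    (p : Mh → M) (hp : IsMinimalCovering θ p)
    (lam : Mh → ℝ) (hlam : IsPrimitive p θ lam)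
    (Ω₀ : DForm E Mh 2) (hΩ₀ : Ω₀ = conf lam (pullback p Ω)) :
    ∃ _ : MulAction G Mh,
      ContMDiffSMul 𝓘(ℝ, EG) 𝓘(ℝ, E) ∞ G Mh ∧
      (∀ (g : G) (x : Mh), p (g • x) = g • p x) ∧
      ∀ g : G, pullback (fun x : Mh => g • x) Ω₀ = Ω₀ := by
  subst hΩ₀
  have hpd := hp.1.local_diffeo
  choose act hact using exists_isConformalLift hG hp.1 hlam
  have hunique {g : G} {x y : Mh} : IsConformalLift Ω p lam g x y → act g x = y :=
    hp.isConformalLift_unique hlam hΩ (hact g x)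
  have hcont := continuous_of_isConformalLift hΩ hG hp hlam hact
  have hsmooth : ContMDiff (𝓘(ℝ, EG).prod 𝓘(ℝ, E)) 𝓘(ℝ, E) ∞ fun q : G × Mh => act q.1 q.2 :=
    fun q => contMDiffAt_of_lift hpd hcont.continuousAt <|
      ((contMDiff_fst.smul (hpd.contMDiff.comp contMDiff_snd)).congr
        fun q => (hact q.1 q.2).1).contMDiffAt
  let inst : MulAction G Mh :=
    { smul := act
      one_smul := fun x => hunique (.one x)
      mul_smul := fun g h x => hunique ((hact g (act h x)).mul (EG := EG) (hact h x)) }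
  have hsmul : ContMDiffSMul 𝓘(ℝ, EG) 𝓘(ℝ, E) ∞ G Mh := ⟨hsmooth⟩
  exact ⟨inst, hsmul, fun g x => (hact g x).1, fun g =>
    IsConformalLift.pullback_conf (EG := EG) (hpd.mdifferentiable (by simp))
      ((ContMDiffSMul.contMDiff_const_smul (I := 𝓘(ℝ, EG)) (n := ∞) g).mdifferentiable (by simp))
      (hact g)⟩

end LCS

open scoped Manifold ContDiff in
open LCS in
theorem lemma4p5
    {E : Type*} [NormedAddCommGroup E] [NormedSpace ℝ E] [FiniteDimensional ℝ E]
    {EG : Type*} [NormedAddCommGroup EG] [NormedSpace ℝ EG] [FiniteDimensional ℝ EG]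
    -- a connected Lie group
    {G : Type*} [TopologicalSpace G] [ChartedSpace EG G] [Group G]
    [LieGroup 𝓘(ℝ, EG) ∞ G] [ConnectedSpace G]
    -- a connected lcs manifold
    {M : Type*} [TopologicalSpace M] [ChartedSpace E M] [IsManifold 𝓘(ℝ, E) ∞ M]
    [T2Space M] [SecondCountableTopology M] [ConnectedSpace M]
    (Ω : DForm E M 2) (θ : OneForm E M) (hΩ : IsLCS Ω) (hθ : IsLeeForm Ω θ)
    -- a smooth special lcs action
    [MulAction G M] [ContMDiffSMul 𝓘(ℝ, EG) 𝓘(ℝ, E) ∞ G M]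
    (hG : IsSpecialAction EG G Ω θ)
    -- the minimal covering, with its symplectic form `Ω₀ = e^{-lam} p^* Ω`
    {Mh : Type*} [TopologicalSpace Mh] [ChartedSpace E Mh] [IsManifold 𝓘(ℝ, E) ∞ Mh]
    (p : Mh → M) (hp : IsMinimalCovering θ p)
    (lam : Mh → ℝ) (hlam : IsPrimitive p θ lam)
    (Ω₀ : DForm E Mh 2) (hΩ₀ : Ω₀ = conf lam (pullback p Ω)) :
    ∃ _ : MulAction G Mh,
      ContMDiffSMul 𝓘(ℝ, EG) 𝓘(ℝ, E) ∞ G Mh ∧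
      (∀ (g : G) (x : Mh), p (g • x) = g • p x) ∧
      ∀ g : G, pullback (fun x : Mh => g • x) Ω₀ = Ω₀ := by
  have : Nontrivial E := Module.nontrivial_of_finrank_pos (pos_of_gt hΩ.two_lt_dim)
  exact lemma4p5_general Ω θ hΩ.nondegenerate hθ hG p hp lam hlam Ω₀ hΩ₀
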